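/- Let $\mathcal X,\mathcal Y$ be finite nonempty alphabets and $P_{Y|X}$ a channel from $\mathcal X$ to $\mathcal Y$. For an integer $M\ge 1$ put $\mathcal S=\widehat{\mathcal S}=\{1,\dots,M\}$, $P_S(s)=1/M$ and $\kappa(s,x,y,\widehat s)=\mathbb I\{s\ne\widehat s\}$. A (randomized) code is a pair of conditional distributions $(Q_{X|S},Q_{\widehat S|Y})$; its error probability is $$\mathbb E[\mathbb I\{S\ne\widehat S\}]=\sum_{s,x,y,\widehat s}\kappa(s,x,y,\widehat s)\,P_S(s)Q_{X|S}(x|s)P_{Y|X}(y|x)Q_{\widehat S|Y}(\widehat s|y).$$ A deterministic code is a pair of maps $f:\mathcal S\to\mathcal X$, $g:\mathcal Y\to\widehat{\mathcal S}$, identified with the code $Q_{X|S}(x|s)=\mathbb I\{x=f(s)\}$, $Q_{\widehat S|Y}(\widehat s|y)=\mathbb I\{\widehat s=g(y)\}$. Let $\mathrm{OPT}(\mathrm{SC})$ be the infimum of the error probability over all randomized codes. Consider the following programs. * $\mathrm{LP}'$: minimize $\sum_{s,x,y,\widehat s}\kappa(s,x,y,\widehat s)P_S(s)P_{Y|X}(y|x)W(s,x,y,\widehat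 s)$ over real-valued $Q_{X|S},Q_{\widehat S|Y},W\ge 0$ such that, for all $s,x,y,\widehat s$, $\sum_{x'}Q_{X|S}(x'|s)=1$, $\sum_{s'}Q_{\widehat S|Y}(s'|y)=1$, $\sum_{x'} W(s,x',y,\widehat s)=Q_{\widehat S|Y}(\widehat s|y)$ and $\sum_{s'}W(s,x,y,s')=Q_{X|S}(x|s)$. * $\mathrm{NS}$ (Matthews' non-signaling program): minimize $1-\frac1M\sum_{s,x,y}P_{Y|X}(y|x)W(s,x,y,s)$ over $Q_{X|S},Q_{\widehat S|Y},W\ge0$ such that, for all $s,x,y,\widehat s$, $\sum_{x'} W(s,x',y,\widehat s)=Q_{\widehat S|Y}(\widehat s|y)$, $\sum_{s'}W(s,x,y,s')=Q_{X|S}(x|s)$ and $\sum_{x',s'}W(s,x',y,s')=1$. * $\mathrm{DP}$: maximize $\sum_s\gamma^a(s)+\sum_y\gamma^b(y)-\sum_{s,x,y,\widehat s}\mu(s,x,y,\widehat s)$ over real-valued $\gamma^a(s),\gamma^b(y),\lambda^a(s,\widehat s,y),\lambda^b(x,s,y)$ and $\mu(s,x,y,\widehat s)\ge0$ such that $\gamma^a(s)-\sum_y\lambda^b(x,s,y)-\sum_{\widehat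 s,y}\mu(s,x,y,\widehat s)\le0$ for all $x,s$; $\gamma^b(y)-\sum_s\lambda^a(s,\widehat s,y)-\sum_{x,s}\mu(s,x,y,\widehat s)\le0$ for all $\widehat s,y$; $\lambda^a(s,\widehat s,y)+\lambda^b(x,s,y)+\mu(s,x,y,\widehat s)\le\kappa(s,x,y,\widehat s)P_S(s)P_{Y|X}(y|x)$ for all $s,x,y,\widehat s$. * $\mathrm{DP}'$: the program $\mathrm{DP}$ with $\mu\equiv0$. **Theorem (DP implies the Polyanskiy–Poor–Verdú converse).** (i) For every $M\ge1$, $\mathrm{NS}$ and $\mathrm{LP}'$ have the same feasible region and their objectives agree on it; moreover $$\mathrm{OPT}(\mathrm{NS})=\mathrm{OPT}(\mathrm{LP}')=\mathrm{OPT}(\mathrm{DP}').$$ (ii) For every $M\ge1$ and every code, $$\mathbb E[\mathbb I\{S\ne\widehat S\}]\ \ge\ \mathrm{OPT}(\mathrm{SC})\ \ge\ \mathrm{OPT}(\mathrm{DP})\ \ge\ \mathrm{OPT}(\mathrm{DP}'),$$ and $\mathrm{OPT}(\mathrm{SC})$ is unchanged if only deterministic codes are allowed. (iii) For $0\le\epsilon<1$,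 let $M(\epsilon)$ be the largest $M\ge1$ for which a deterministic code with error probability at most $\epsilon$ exists, let $M^{\mathrm{DP}'}(\epsilon)$ be the largest $M\ge1$ with $\mathrm{OPT}(\mathrm{DP}')\le\epsilon$ (the program $\mathrm{DP}'$ being formed with $M$ messages), and let $$M^{\mathrm{PPV}}(\epsilon)=\sup_{P_X}\ \inf_{Q_Y}\ \frac1{\beta_{1-\epsilon}(P_{XY},P_X\times Q_Y)},\qquad P_{XY}(x,y)=P_{Y|X}(y|x)P_X(x),$$ over probability distributions $P_X$ on $\mathcal X$ and $Q_Y$ on $\mathcal Y$, with $1/0=\infty$, where $\beta_{1-\epsilon}(P,Q)$ is the minimum of $\sum_rT(r)Q(r)$ over $T$ with values in $[0,1]$ and $\sum_rT(r)P(r)\ge1-\epsilon$. Then both maxima exist, $M^{\mathrm{PPV}}(\epsilon)<\infty$, and $$M(\epsilon)\ \le\ M^{\mathrm{DP}'}(\epsilon)\ =\ \lfloor M^{\mathrm{PPV}}(\epsilon)\rfloor .$$ -/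

import Mathlib

open scoped ENNReal

noncomputable section

namespace SourceChannel

/-- Conditional probability distributions `Q(b|a)`, written `Q a b`. -/
def condDist (A B : Type*) [Fintype B] : Set (A → B → ℝ) :=
  {Q | ∀ a, Q a ∈ stdSimplex ℝ B}

section General

variable {S X Y S' : Type*} [Fintype S] [Fintype X] [Fintype Y] [Fintype S']

/-- The joint distribution `P_S(s) Q_{X|S}(x|s) P_{Y|X}(y|x) Q_{S'|Y}(s'|y)`. -/
def jointDist (PS : S → ℝ) (P : X → Y → ℝ) (QX : S → X → ℝ) (QS : Y → S' → ℝ) :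
    S → X → Y → S' → ℝ :=
  fun s x y s' => PS s * QX s x * P x y * QS y s'

/-- Expected loss of the randomized code with encoder `QX` and decoder `QS`. -/
def expectedLoss (PS : S → ℝ) (P : X → Y → ℝ) (κ : S → X → Y → S' → ℝ)
    (QX : S → X → ℝ) (QS : Y → S' → ℝ) : ℝ :=
  ∑ s, ∑ x, ∑ y, ∑ s', κ s x y s' * jointDist PS P QX QS s x y s'

/-- Expected loss of the deterministic code `(f, g)`. -/
def codeLoss (PS : S → ℝ) (P : X → Y → ℝ) (κ : S → X → Y → S' → ℝ)
    (f : S → X) (g : Y → S') : ℝ :=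
  ∑ s, ∑ y, κ s (f s) y (g y) * (PS s * P (f s) y)

/-- Optimal value of SC over deterministic codes. -/
def optSCDet (PS : S → ℝ) (P : X → Y → ℝ) (κ : S → X → Y → S' → ℝ) : EReal :=
  ⨅ (f : S → X) (g : Y → S'), (codeLoss PS P κ f g : EReal)

/-- Optimal value of SC in its continuous formulation, over randomized codes. -/
def optSC (PS : S → ℝ) (P : X → Y → ℝ) (κ : S → X → Y → S' → ℝ) : EReal :=
  ⨅ (QX ∈ condDist S X) (QS ∈ condDist Y S'), (expectedLoss PS P κ QX QS : EReal)

/-- The variables `(Q_{X|S}, Q_{S'|Y}, W)` of the linear relaxations. -/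
structure PrimalPoint (S X Y S' : Type*) where
  QX : S → X → ℝ
  QS : Y → S' → ℝ
  W : S → X → Y → S' → ℝ

/-- Feasible region of LP'. -/
def feaLP' (S X Y S' : Type*) [Fintype X] [Fintype S'] : Set (PrimalPoint S X Y S') :=
  {v | (∀ s, ∑ x, v.QX s x = 1) ∧
    (∀ y, ∑ s', v.QS y s' = 1) ∧
    (∀ s s' y, ∑ x, v.W s x y s' - v.QS y s' = 0) ∧
    (∀ x s y, ∑ s', v.W s x y s' - v.QX s x = 0) ∧
    (∀ s x, 0 ≤ v.QX s x) ∧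
    (∀ s' y, 0 ≤ v.QS y s') ∧
    (∀ s x y s', 0 ≤ v.W s x y s')}

/-- Objective function of LP'. -/
def objLP' (PS : S → ℝ) (P : X → Y → ℝ) (κ : S → X → Y → S' → ℝ)
    (v : PrimalPoint S X Y S') : ℝ :=
  ∑ s, ∑ x, ∑ y, ∑ s', κ s x y s' * PS s * P x y * v.W s x y s'

/-- Optimal value of LP'. -/
def optLP' (PS : S → ℝ) (P : X → Y → ℝ) (κ : S → X → Y → S' → ℝ) : EReal :=
  ⨅ v ∈ feaLP' S X Y S', (objLP' PS P κ v : EReal)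

/-- The dual variables `γᵃ(s), γᵇ(y), λᵃ(s,s',y), λᵇ(x,s,y), μ(s,x,y,s')`. -/
structure DualPoint (S X Y S' : Type*) where
  γa : S → ℝ
  γb : Y → ℝ
  la : S → S' → Y → ℝ
  lb : X → S → Y → ℝ
  μ : S → X → Y → S' → ℝ

/-- Feasible region of DP. -/
def feaDP (PS : S → ℝ) (P : X → Y → ℝ) (κ : S → X → Y → S' → ℝ) :
    Set (DualPoint S X Y S') :=
  {v | (∀ x s, v.γa s - ∑ y, v.lb x s y - ∑ s', ∑ y, v.μ s x y s' ≤ 0) ∧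
    (∀ s' y, v.γb y - ∑ s, v.la s s' y - ∑ x, ∑ s, v.μ s x y s' ≤ 0) ∧
    (∀ s x y s', v.la s s' y + v.lb x s y + v.μ s x y s' ≤ κ s x y s' * PS s * P x y) ∧
    (∀ s x y s', 0 ≤ v.μ s x y s')}

/-- Objective function of DP. -/
def objDP (v : DualPoint S X Y S') : ℝ :=
  ∑ s, v.γa s + ∑ y, v.γb y - ∑ s, ∑ x, ∑ y, ∑ s', v.μ s x y s'

/-- Optimal value of DP. -/
def optDP (PS : S → ℝ) (P : X → Y → ℝ) (κ : S → X → Y → S' → ℝ) : EReal :=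
  ⨆ v ∈ feaDP PS P κ, (objDP v : EReal)

/-- Feasible region of DP': that of DP with `μ` identically zero. -/
def feaDP' (PS : S → ℝ) (P : X → Y → ℝ) (κ : S → X → Y → S' → ℝ) :
    Set (DualPoint S X Y S') :=
  {v | v ∈ feaDP PS P κ ∧ ∀ s x y s', v.μ s x y s' = 0}

/-- Optimal value of DP'. -/
def optDP' (PS : S → ℝ) (P : X → Y → ℝ) (κ : S → X → Y → S' → ℝ) : EReal :=
  ⨆ v ∈ feaDP' PS P κ, (objDP v : EReal)

end General

section ChannelCoding

variable {X Y : Type*} [Fintype X] [Fintype Y]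

/-- The uniform distribution on `M` messages. -/
def unif (M : ℕ) : Fin M → ℝ := fun _ => 1 / (M : ℝ)

/-- The loss `𝕀{s ≠ s'}`. -/
def errLoss (X Y : Type*) (M : ℕ) : Fin M → X → Y → Fin M → ℝ :=
  fun s _ _ s' => if s ≠ s' then 1 else 0

/-- Feasible region of the non-signaling program NS with `M` messages. -/
def feaNS (X Y : Type*) [Fintype X] (M : ℕ) : Set (PrimalPoint (Fin M) X Y (Fin M)) :=
  {v | (∀ s s' y, ∑ x, v.W s x y s' - v.QS y s' = 0) ∧
    (∀ x s y, ∑ s', v.W s x y s' - v.QX s x = 0) ∧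
    (∀ s y, ∑ x, ∑ s', v.W s x y s' = 1) ∧
    (∀ s x, 0 ≤ v.QX s x) ∧
    (∀ s' y, 0 ≤ v.QS y s') ∧
    (∀ s x y s', 0 ≤ v.W s x y s')}

/-- Objective function of NS. -/
def objNS (P : X → Y → ℝ) (M : ℕ) (v : PrimalPoint (Fin M) X Y (Fin M)) : ℝ :=
  1 - 1 / (M : ℝ) * ∑ s, ∑ x, ∑ y, P x y * v.W s x y s

/-- Optimal value of NS. -/
def optNS (P : X → Y → ℝ) (M : ℕ) : EReal :=
  ⨅ v ∈ feaNS X Y M, (objNS P M v : EReal)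

/-- The sizes `M ≥ 1` for which some deterministic code has error probability at most `ε`. -/
def achievableSizes (P : X → Y → ℝ) (ε : ℝ) : Set ℕ :=
  {M | 1 ≤ M ∧ ∃ (f : Fin M → X) (g : Y → Fin M), codeLoss (unif M) P (errLoss X Y M) f g ≤ ε}

/-- `M(ε)`, the largest size of a code with error probability at most `ε`. -/
def maxCodeSize (P : X → Y → ℝ) (ε : ℝ) : ℕ :=
  sSup (achievableSizes P ε)

/-- The sizes `M ≥ 1` not excluded by `OPT(DP') ≤ ε`. -/
def sizesDP' (P : X → Y → ℝ) (ε : ℝ) : Set ℕ :=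
  {M | 1 ≤ M ∧ optDP' (unif M) P (errLoss X Y M) ≤ (ε : EReal)}

/-- `M^{DP'}(ε)`, the largest size not excluded by `OPT(DP') ≤ ε`. -/
def maxSizeDP' (P : X → Y → ℝ) (ε : ℝ) : ℕ :=
  sSup (sizesDP' P ε)

/-- Randomized tests `T` of `P` (null hypothesis) with type I error at most `1 - α`. -/
def tests {R : Type*} [Fintype R] (α : ℝ) (P : R → ℝ) : Set (R → ℝ) :=
  {T | (∀ r, 0 ≤ T r ∧ T r ≤ 1) ∧ α ≤ ∑ r, T r * P r}

/-- `β_α(P, Q)`, the least type II error of such a test. -/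
def beta {R : Type*} [Fintype R] (α : ℝ) (P Q : R → ℝ) : ℝ≥0∞ :=
  ⨅ T ∈ tests α P, ENNReal.ofReal (∑ r, T r * Q r)

/-- The bound `M^{PPV}(ε) = sup_{P_X} inf_{Q_Y} 1 / β_{1-ε}(P_{XY}, P_X × Q_Y)`,
with `1 / 0 = ∞`. -/
def boundPPV (P : X → Y → ℝ) (ε : ℝ) : ℝ≥0∞ :=
  ⨆ PX ∈ stdSimplex ℝ X, ⨅ QY ∈ stdSimplex ℝ Y,
    (beta (1 - ε) (fun r : X × Y => P r.1 r.2 * PX r.1) (fun r : X × Y => PX r.1 * QY r.2))⁻¹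

end ChannelCoding

end SourceChannel

end

/-! Everything in the channel-coding part is governed by one number t*: the least t for which some
input distribution P_X and some weight 0 ≤ R(x,y) ≤ P_X(x) have power ∑ P(y|x) R(x,y) ≥ 1 - ε and
every output total ∑_x R(x,y) at most t (`testLevels`).

On the linear programming side, averaging the diagonal W(s,x,y,s) over s turns an LP' point of value
at most ε into a weight of level 1/M. Conversely, a weight of level 1/M can be padded until all
output totals equal 1/M, then spread symmetrically over the messages. Hence the value is at most ε
exactly when M ≤ 1/t* (`mem_sizesDP'_iff`).

On the hypothesis testing side, put R = P_X T. The type II error of T against P_X × Q_Y is the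
Q_Y-average of the output totals of R. A minimax argument by separation
(`exists_stdSimplex_forall_le`) then gives M^PPV = 1/t* (`boundPPV_eq`).

The link to DP' is strong duality: the marginal constraints of LP' receive Lagrange multipliers over
a compact domain obtained by adding the redundant bound W ≤ 1, whose own multiplier is absorbed into
λᵇ. The bound of SC by DP is weak duality for W = Q_{X|S} Q_{Ŝ|Y}, where μ is paid for by (1 - a)(1
- b) ≥ 0. Deterministic codes suffice because the loss is affine in the encoder and in the decoder
separately. -/

noncomputable section

namespace SourceChannel

/-! ### Separation theorems: Lagrange multipliers and a minimax principle. -/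

section Separation

variable {E ι : Type*} [TopologicalSpace E] [AddCommGroup E] [Module ℝ E] [Fintype ι]

/-- Lagrange multipliers for a linear program over a compact convex set. -/
theorem exists_multiplier {K : Set E} (hK : IsCompact K) (hconv : Convex ℝ K)
    (A : E →ₗ[ℝ] ι → ℝ) (hA : Continuous A) (c : E →ₗ[ℝ] ℝ) (hc : Continuous c)
    {v₀ : E} (hv₀ : v₀ ∈ K) (hAv₀ : A v₀ = 0) {r : ℝ}
    (h : ∀ v ∈ K, A v = 0 → r < c v) :
    ∃ l : ι → ℝ, ∀ v ∈ K, r ≤ c v + ∑ i, l i * A v i := by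
  classical
  -- The point (0, r) is strictly separated from the compact convex image of K under (A, c); it is
  -- not in the image because c > r wherever A = 0.
  obtain ⟨f, u, w, hf1, huw, hf2⟩ := geometric_hahn_banach_closed_compact
    (s := {((0 : ι → ℝ), r)}) (t := (A.prod c) '' K) (convex_singleton _) isClosed_singleton
    (hconv.linear_image _) (hK.image (hA.prodMk hc)) (by
      rw [Set.disjoint_singleton_left]
      rintro ⟨v, hv, hvr⟩
      exact (h v hv (congrArg Prod.fst hvr)).ne' (congrArg Prod.snd hvr))
  have hsplit : ∀ (z : ι → ℝ) (t : ℝ), f (z, t) =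
      (∑ i, z i * f ((fun j => if i = j then 1 else 0), 0)) + t * f (0, 1) := by
    intro z t
    have h1 : (z, t) = (z, (0 : ℝ)) + t • ((0 : ι → ℝ), (1 : ℝ)) := by ext <;> simp
    rw [h1, map_add, map_smul, smul_eq_mul]
    congr 1
    exact LinearMap.pi_apply_eq_sum_univ (f.toLinearMap ∘ₗ LinearMap.inl ℝ (ι → ℝ) ℝ) z
  have hr : r * f (0, 1) < u := by
    have := hf1 _ rfl
    rwa [hsplit, Finset.sum_eq_zero (by simp), zero_add] at this
  have hK' : ∀ v ∈ K, u < (∑ i, A v i * f ((fun j => if i = j then 1 else 0), 0)) +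
      c v * f (0, 1) := by
    intro v hv
    have h1 : w < f (A v, c v) := hf2 _ ⟨v, hv, rfl⟩
    rw [hsplit] at h1
    exact huw.trans h1
  -- The hyperplane is not vertical: (0, c v₀) lies directly above (0, r) and on the other side.
  -- Dividing by this coefficient normalises the multipliers.
  have hτ : 0 < f (0, 1) := by
    have h1 := hK' v₀ hv₀
    rw [hAv₀, Finset.sum_eq_zero (by simp), zero_add] at h1
    have h2 := h v₀ hv₀ hAv₀
    by_contra hcon
    nlinarith
  refine ⟨fun i => f ((fun j => if i = j then 1 else 0), 0) / f (0, 1), fun v hv => ?_⟩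
  have h1 := hr.trans (hK' v hv)
  have h2 : ∑ i, f ((fun j => if i = j then 1 else 0), 0) / f (0, 1) * A v i =
      (∑ i, A v i * f ((fun j => if i = j then 1 else 0), 0)) / f (0, 1) := by
    rw [Finset.sum_div]
    exact Finset.sum_congr rfl fun i _ => by ring
  rw [h2, ← sub_le_iff_le_add', le_div_iff₀ hτ]
  linarith

/-- If every point of a compact convex set has a coordinate at least `t`, then some probability
vector gives every point of the set average at least `t`. -/
theorem exists_stdSimplex_forall_le {K : Set (ι → ℝ)} (hne : K.Nonempty) (hconv : Convex ℝ K)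
    {t : ℝ} (h : ∀ z ∈ K, ∃ i, t ≤ z i) :
    ∃ q ∈ stdSimplex ℝ ι, ∀ z ∈ K, t ≤ ∑ i, q i * z i := by
  classical
  have hopen : IsOpen (Set.univ.pi fun _ : ι => Set.Iio t) :=
    isOpen_set_pi Set.finite_univ fun _ _ => isOpen_Iio
  -- K misses the open orthant of points with all coordinates below t; the normal of a separating
  -- hyperplane, normalised, is the probability vector.
  obtain ⟨f, u, hf1, hf2⟩ := geometric_hahn_banach_open
    (s := Set.univ.pi fun _ : ι => Set.Iio t) (t := K)
    (convex_pi fun _ _ => convex_Iio t) hopen hconv (by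
      rw [Set.disjoint_left]
      intro z hz hzK
      obtain ⟨i, hi⟩ := h z hzK
      exact absurd (hz i trivial) (not_lt.2 hi))
  set a : ι → ℝ := fun i => f (fun j => if i = j then 1 else 0) with ha
  have hf : ∀ z, f z = ∑ i, a i * z i := by
    intro z
    rw [← ContinuousLinearMap.coe_coe, LinearMap.pi_apply_eq_sum_univ]
    exact Finset.sum_congr rfl fun i _ => by rw [smul_eq_mul, mul_comm]; rfl
  have hbelow : ∀ z : ι → ℝ, (∀ i, z i < t) → ∑ i, a i * z i < u := by
    intro z hz
    rw [← hf]
    exact hf1 z fun i _ => hz i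
  have hanonneg : ∀ i, 0 ≤ a i := by
    intro i
    by_contra hi
    push Not at hi
    -- Lowering coordinate i by n stays in the orthant, so a negative `a i` would make the
    -- functional unbounded above there.
    have key : ∀ n : ℝ, 0 ≤ n → (∑ j, a j) * (t - 1) - n * a i < u := by
      intro n hn
      have := hbelow (fun j => t - 1 - if j = i then n else 0) (fun j => by
        show t - 1 - (if j = i then n else 0) < t
        split_ifs <;> linarith)
      simp only [mul_sub, Finset.sum_sub_distrib, mul_ite, mul_zero, Finset.sum_ite_eq',
        Finset.mem_univ, if_true] at this
      rw [Finset.sum_mul, mul_comm n]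
      simp only [mul_sub, Finset.sum_sub_distrib]
      exact this
    have h1 := key (|u - (∑ j, a j) * (t - 1)| / (-a i)) (by
      apply div_nonneg (abs_nonneg _); linarith)
    have h2 : |u - (∑ j, a j) * (t - 1)| / (-a i) * a i = -|u - (∑ j, a j) * (t - 1)| := by
      field_simp [hi.ne]
    rw [h2] at h1
    have := le_abs_self (u - (∑ j, a j) * (t - 1))
    linarith
  have hle : (∑ i, a i) * t ≤ u := by
    by_contra hcon
    push Not at hcon
    have hs : 0 ≤ ∑ i, a i := Finset.sum_nonneg fun i _ => hanonneg i
    -- The 1 in the denominator keeps it positive and makes δ ∑ a smaller than the gap, so the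
    -- constant vector t - δ already violates the bound u.
    set δ := ((∑ i, a i) * t - u) / ((∑ i, a i) + 1) with hδ
    have hδpos : 0 < δ := div_pos (by linarith) (by linarith)
    have h1 := hbelow (fun _ => t - δ) (fun _ => by linarith)
    rw [← Finset.sum_mul] at h1
    have h2 : δ * ((∑ i, a i) + 1) = (∑ i, a i) * t - u := div_mul_cancel₀ _ (by linarith)
    nlinarith
  have hpos : 0 < ∑ i, a i := by
    refine (Finset.sum_nonneg fun i _ => hanonneg i).lt_of_ne' fun h0 => ?_
    have hz : ∀ i, a i = 0 := fun i =>
      (Finset.sum_eq_zero_iff_of_nonneg fun i _ => hanonneg i).1 h0 i (Finset.mem_univ i)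
    have h1 := hbelow (fun _ => t - 1) (fun _ => by linarith)
    obtain ⟨z, hzK⟩ := hne
    have h2 := hf2 z hzK
    rw [hf] at h2
    simp only [hz, zero_mul, Finset.sum_const_zero] at h1 h2
    linarith
  refine ⟨fun i => a i / ∑ j, a j, ⟨fun i => div_nonneg (hanonneg i) hpos.le, ?_⟩, ?_⟩
  · rw [← Finset.sum_div, div_self hpos.ne']
  · intro z hz
    have h1 := hf2 z hz
    rw [hf] at h1
    have h2 : ∑ i, a i / (∑ j, a j) * z i = (∑ i, a i * z i) / ∑ j, a j := by
      rw [Finset.sum_div]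
      exact Finset.sum_congr rfl fun i _ => by ring
    rw [h2, le_div_iff₀ hpos]
    linarith

end Separation

/-! ### Weak duality and optimality of deterministic codes. -/

section General

variable {S X Y S' : Type*} [Fintype S] [Fintype X] [Fintype Y] [Fintype S']

theorem sum_rotate_decoder (F : S → X → Y → S' → ℝ) :
    ∑ y, ∑ s', ∑ s, ∑ x, F s x y s' = ∑ s, ∑ x, ∑ y, ∑ s', F s x y s' := by
  calc ∑ y, ∑ s', ∑ s, ∑ x, F s x y s' = ∑ y, ∑ s, ∑ x, ∑ s', F s x y s' := by
        refine Finset.sum_congr rfl fun y _ => ?_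
        rw [Finset.sum_comm]
        exact Finset.sum_congr rfl fun s _ => Finset.sum_comm
    _ = _ := by
        rw [Finset.sum_comm]
        exact Finset.sum_congr rfl fun s _ => Finset.sum_comm

/-- Weak duality between LP' and DP'. -/
theorem optDP'_le_optLP' (PS : S → ℝ) (P : X → Y → ℝ) (κ : S → X → Y → S' → ℝ) :
    optDP' PS P κ ≤ optLP' PS P κ := by
  refine iSup₂_le fun d hd => le_iInf₂ fun v hv => ?_
  rw [EReal.coe_le_coe_iff]
  obtain ⟨⟨h1, h2, h3, -⟩, hμ⟩ := hd
  obtain ⟨hX, hS, hWS, hWX, hXn, hSn, hWn⟩ := hv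
  simp only [hμ, Finset.sum_const_zero, sub_zero, add_zero] at h1 h2 h3
  -- The dual constraint is averaged against `v.QX`, which the marginal constraint then rewrites as
  -- a sum of W; `e2` does the same for the decoder.
  have e1 : ∑ s, d.γa s ≤ ∑ s, ∑ x, ∑ y, ∑ s', v.W s x y s' * d.lb x s y := by
    refine Finset.sum_le_sum fun s _ => ?_
    calc d.γa s = ∑ x, v.QX s x * d.γa s := by rw [← Finset.sum_mul, hX, one_mul]
      _ ≤ ∑ x, v.QX s x * ∑ y, d.lb x s y := Finset.sum_le_sum fun x _ =>
          mul_le_mul_of_nonneg_left (by linarith [h1 x s]) (hXn s x)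
      _ = _ := by
          refine Finset.sum_congr rfl fun x _ => ?_
          rw [Finset.mul_sum]
          refine Finset.sum_congr rfl fun y _ => ?_
          rw [← Finset.sum_mul, sub_eq_zero.1 (hWX x s y)]
  have e2 : ∑ y, d.γb y ≤ ∑ s, ∑ x, ∑ y, ∑ s', v.W s x y s' * d.la s s' y := by
    rw [← sum_rotate_decoder]
    refine Finset.sum_le_sum fun y _ => ?_
    calc d.γb y = ∑ s', v.QS y s' * d.γb y := by rw [← Finset.sum_mul, hS, one_mul]
      _ ≤ ∑ s', v.QS y s' * ∑ s, d.la s s' y := Finset.sum_le_sum fun s' _ =>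
          mul_le_mul_of_nonneg_left (by linarith [h2 s' y]) (hSn s' y)
      _ = _ := by
          refine Finset.sum_congr rfl fun s' _ => ?_
          rw [Finset.mul_sum]
          refine Finset.sum_congr rfl fun s _ => ?_
          rw [← Finset.sum_mul, sub_eq_zero.1 (hWS s s' y)]
  have e3 : (∑ s, ∑ x, ∑ y, ∑ s', v.W s x y s' * d.lb x s y) +
      (∑ s, ∑ x, ∑ y, ∑ s', v.W s x y s' * d.la s s' y) ≤ objLP' PS P κ v := by
    simp only [objLP', ← Finset.sum_add_distrib]
    gcongr with s _ x _ y _ s' _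
    nlinarith [h3 s x y s', hWn s x y s']
  simp only [objDP, hμ, Finset.sum_const_zero, sub_zero]
  linarith

/-- Weak duality between SC and DP. -/
theorem optDP_le_optSC (PS : S → ℝ) (P : X → Y → ℝ) (κ : S → X → Y → S' → ℝ) :
    optDP PS P κ ≤ optSC PS P κ := by
  refine iSup₂_le fun d hd => le_iInf₂ fun QX hQX => le_iInf₂ fun QS hQS => ?_
  rw [EReal.coe_le_coe_iff]
  obtain ⟨h1, h2, h3, hμ⟩ := hd
  have hX1 : ∀ s x, QX s x ≤ 1 := fun s x => by
    rw [← (hQX s).2]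
    exact Finset.single_le_sum (fun i _ => (hQX s).1 i) (Finset.mem_univ x)
  have hS1 : ∀ y s', QS y s' ≤ 1 := fun y s' => by
    rw [← (hQS y).2]
    exact Finset.single_le_sum (fun i _ => (hQS y).1 i) (Finset.mem_univ s')
  have e1 : ∑ s, d.γa s ≤ ∑ s, ∑ x, ∑ y, ∑ s',
      (QX s x * QS y s' * d.lb x s y + QX s x * d.μ s x y s') := by
    refine Finset.sum_le_sum fun s _ => ?_
    calc d.γa s = ∑ x, QX s x * d.γa s := by rw [← Finset.sum_mul, (hQX s).2, one_mul]
      _ ≤ ∑ x, QX s x * (∑ y, d.lb x s y + ∑ s', ∑ y, d.μ s x y s') :=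
          Finset.sum_le_sum fun x _ =>
            mul_le_mul_of_nonneg_left (by linarith [h1 x s]) ((hQX s).1 x)
      _ = _ := by
          refine Finset.sum_congr rfl fun x _ => ?_
          rw [Finset.sum_comm (γ := S'), ← Finset.sum_add_distrib, Finset.mul_sum]
          refine Finset.sum_congr rfl fun y _ => ?_
          rw [Finset.sum_add_distrib, ← Finset.sum_mul, ← Finset.mul_sum, ← Finset.mul_sum,
            (hQS y).2]
          ring
  have e2 : ∑ y, d.γb y ≤ ∑ s, ∑ x, ∑ y, ∑ s',
      (QX s x * QS y s' * d.la s s' y + QS y s' * d.μ s x y s') := by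
    rw [← sum_rotate_decoder]
    refine Finset.sum_le_sum fun y _ => ?_
    calc d.γb y = ∑ s', QS y s' * d.γb y := by rw [← Finset.sum_mul, (hQS y).2, one_mul]
      _ ≤ ∑ s', QS y s' * (∑ s, d.la s s' y + ∑ x, ∑ s, d.μ s x y s') :=
          Finset.sum_le_sum fun s' _ =>
            mul_le_mul_of_nonneg_left (by linarith [h2 s' y]) ((hQS y).1 s')
      _ = _ := by
          refine Finset.sum_congr rfl fun s' _ => ?_
          rw [Finset.sum_comm (γ := X), ← Finset.sum_add_distrib, Finset.mul_sum]
          refine Finset.sum_congr rfl fun s _ => ?_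
          rw [Finset.sum_add_distrib, ← Finset.sum_mul, ← Finset.mul_sum, ← Finset.sum_mul,
            (hQX s).2]
          ring
  have e3 : (∑ s, ∑ x, ∑ y, ∑ s', (QX s x * QS y s' * d.lb x s y + QX s x * d.μ s x y s')) +
      (∑ s, ∑ x, ∑ y, ∑ s', (QX s x * QS y s' * d.la s s' y + QS y s' * d.μ s x y s')) -
      (∑ s, ∑ x, ∑ y, ∑ s', d.μ s x y s') ≤ expectedLoss PS P κ QX QS := by
    simp only [expectedLoss, jointDist, ← Finset.sum_add_distrib, ← Finset.sum_sub_distrib]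
    gcongr with s _ x _ y _ s' _
    have hq : 0 ≤ QX s x * QS y s' := mul_nonneg ((hQX s).1 x) ((hQS y).1 s')
    -- In total μ has coefficient a + b - 1 with a = `QX s x`, b = `QS y s'`. This is at most ab,
    -- the weight with which μ enters the third dual constraint.
    have hm : 0 ≤ d.μ s x y s' * ((1 - QX s x) * (1 - QS y s')) :=
      mul_nonneg (hμ s x y s') (mul_nonneg (by linarith [hX1 s x]) (by linarith [hS1 y s']))
    linarith [mul_le_mul_of_nonneg_left (h3 s x y s') hq]
  simp only [objDP]
  linarith

theorem optDP'_le_optDP (PS : S → ℝ) (P : X → Y → ℝ) (κ : S → X → Y → S' → ℝ) :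
    optDP' PS P κ ≤ optDP PS P κ :=
  biSup_mono fun _ hv => hv.1

theorem single_mem_stdSimplex_ite {A : Type*} [Fintype A] [DecidableEq A] (a : A) :
    (fun b => if b = a then (1 : ℝ) else 0) ∈ stdSimplex ℝ A :=
  ⟨fun b => by dsimp only; split_ifs <;> norm_num, by simp⟩

/-- Deterministic codes are optimal. -/
theorem optSCDet_eq_optSC [Nonempty X] [Nonempty S'] (PS : S → ℝ) (P : X → Y → ℝ)
    (κ : S → X → Y → S' → ℝ) : optSCDet PS P κ = optSC PS P κ := by
  classical
  apply le_antisymm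
  · refine le_iInf₂ fun QX hQX => le_iInf₂ fun QS hQS => ?_
    -- Rounding in two stages: g is a best response to the randomized encoder, then f a best
    -- response to g. Neither stage increases the loss.
    have hg : ∀ y, ∃ a : S', ∀ b : S', ∑ s, ∑ x, κ s x y a * (PS s * QX s x * P x y) ≤
        ∑ s, ∑ x, κ s x y b * (PS s * QX s x * P x y) := fun y => by
      obtain ⟨a, -, ha⟩ := Finset.exists_min_image Finset.univ
        (fun b : S' => ∑ s, ∑ x, κ s x y b * (PS s * QX s x * P x y)) Finset.univ_nonempty
      exact ⟨a, fun b => ha b (Finset.mem_univ b)⟩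
    choose g hg using hg
    have hf : ∀ s, ∃ a : X, ∀ b : X, ∑ y, κ s a y (g y) * (PS s * P a y) ≤
        ∑ y, κ s b y (g y) * (PS s * P b y) := fun s => by
      obtain ⟨a, -, ha⟩ := Finset.exists_min_image Finset.univ
        (fun b : X => ∑ y, κ s b y (g y) * (PS s * P b y)) Finset.univ_nonempty
      exact ⟨a, fun b => ha b (Finset.mem_univ b)⟩
    choose f hf using hf
    refine iInf₂_le_of_le f g ?_
    rw [EReal.coe_le_coe_iff]
    calc codeLoss PS P κ f g
        ≤ ∑ s, ∑ x, QX s x * ∑ y, κ s x y (g y) * (PS s * P x y) := by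
          refine Finset.sum_le_sum fun s _ => ?_
          calc _ = ∑ x, QX s x * ∑ y, κ s (f s) y (g y) * (PS s * P (f s) y) := by
                rw [← Finset.sum_mul, (hQX s).2, one_mul]
            _ ≤ _ := Finset.sum_le_sum fun x _ =>
                mul_le_mul_of_nonneg_left (hf s x) ((hQX s).1 x)
      _ = ∑ y, ∑ s, ∑ x, κ s x y (g y) * (PS s * QX s x * P x y) := by
          rw [Finset.sum_comm (γ := Y)]
          refine Finset.sum_congr rfl fun s _ => ?_
          rw [Finset.sum_comm (γ := Y)]
          refine Finset.sum_congr rfl fun x _ => ?_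
          rw [Finset.mul_sum]
          exact Finset.sum_congr rfl fun y _ => by ring
      _ ≤ ∑ y, ∑ s', QS y s' * ∑ s, ∑ x, κ s x y s' * (PS s * QX s x * P x y) := by
          refine Finset.sum_le_sum fun y _ => ?_
          calc _ = ∑ s', QS y s' * ∑ s, ∑ x, κ s x y (g y) * (PS s * QX s x * P x y) := by
                rw [← Finset.sum_mul, (hQS y).2, one_mul]
            _ ≤ _ := Finset.sum_le_sum fun s' _ =>
                mul_le_mul_of_nonneg_left (hg y s') ((hQS y).1 s')
      _ = expectedLoss PS P κ QX QS := by
          simp only [expectedLoss, jointDist]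
          rw [← sum_rotate_decoder]
          refine Finset.sum_congr rfl fun y _ => Finset.sum_congr rfl fun s' _ => ?_
          simp only [Finset.mul_sum]
          exact Finset.sum_congr rfl fun s _ => Finset.sum_congr rfl fun x _ => by ring
  · refine le_iInf₂ fun f g => ?_
    have hfg : expectedLoss PS P κ (fun s x => if x = f s then 1 else 0)
        (fun y s' => if s' = g y then 1 else 0) = codeLoss PS P κ f g := by
      simp only [expectedLoss, jointDist, codeLoss, mul_ite, mul_one, mul_zero, ite_mul, zero_mul,
        Finset.sum_ite_eq', Finset.mem_univ, if_true]
      refine Finset.sum_congr rfl fun s _ => ?_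
      rw [Finset.sum_comm]
      simp
    rw [← hfg]
    exact iInf₂_le_of_le _ (fun s => single_mem_stdSimplex_ite (f s))
      (iInf₂_le _ (fun y => single_mem_stdSimplex_ite (g y)))

end General

/-! ### LP' as marginal constraints on a compact convex domain. -/

section Marginals

variable {S X Y S' : Type*} [Fintype X] [Fintype S']

/-- Triples `(Q_{X|S}, Q_{S'|Y}, W)` with `W` valued in `[0, 1]`. -/
def boxLP (S X Y S' : Type*) [Fintype X] [Fintype S'] :
    Set ((S → X → ℝ) × (Y → S' → ℝ) × (S → X → Y → S' → ℝ)) :=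
  condDist S X ×ˢ condDist Y S' ×ˢ Set.Icc 0 1

theorem condDist_eq_pi (A B : Type*) [Fintype B] :
    condDist A B = Set.univ.pi fun _ => stdSimplex ℝ B := by
  ext Q; simp [condDist]

/-- The slacks of the two marginal constraints of LP'. -/
def marginalDefect (S X Y S' : Type*) [Fintype X] [Fintype S'] :
    ((S → X → ℝ) × (Y → S' → ℝ) × (S → X → Y → S' → ℝ)) →ₗ[ℝ]
      ((S × S' × Y) ⊕ (X × S × Y) → ℝ) where
  toFun v := Sum.elim (fun i => v.2.1 i.2.2 i.2.1 - ∑ x, v.2.2 i.1 x i.2.2 i.2.1)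
    (fun i => v.1 i.2.1 i.1 - ∑ s', v.2.2 i.2.1 i.1 i.2.2 s')
  map_add' v w := by
    ext (i | i) <;> simp [Finset.sum_add_distrib] <;> ring
  map_smul' c v := by
    ext (i | i) <;> simp [← Finset.mul_sum, mul_sub]

theorem continuous_marginalDefect : Continuous (marginalDefect S X Y S') := by
  refine continuous_pi ?_
  rintro (i | i)
  · change Continuous fun v : (S → X → ℝ) × (Y → S' → ℝ) × (S → X → Y → S' → ℝ) =>
      v.2.1 i.2.2 i.2.1 - ∑ x, v.2.2 i.1 x i.2.2 i.2.1
    fun_prop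
  · change Continuous fun v : (S → X → ℝ) × (Y → S' → ℝ) × (S → X → Y → S' → ℝ) =>
      v.1 i.2.1 i.1 - ∑ s', v.2.2 i.2.1 i.1 i.2.2 s'
    fun_prop

theorem isCompact_boxLP : IsCompact (boxLP S X Y S') := by
  unfold boxLP
  rw [condDist_eq_pi, condDist_eq_pi]
  exact (isCompact_univ_pi fun _ => isCompact_stdSimplex ℝ X).prod
    ((isCompact_univ_pi fun _ => isCompact_stdSimplex ℝ S').prod isCompact_Icc)

theorem convex_boxLP : Convex ℝ (boxLP S X Y S') := by
  unfold boxLP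
  rw [condDist_eq_pi, condDist_eq_pi]
  exact (convex_pi fun _ _ => convex_stdSimplex ℝ X).prod
    ((convex_pi fun _ _ => convex_stdSimplex ℝ S').prod (convex_Icc _ _))

theorem mk_mem_feaLP' {v : (S → X → ℝ) × (Y → S' → ℝ) × (S → X → Y → S' → ℝ)}
    (hv : v ∈ boxLP S X Y S') (h0 : marginalDefect S X Y S' v = 0) :
    (⟨v.1, v.2.1, v.2.2⟩ : PrimalPoint S X Y S') ∈ feaLP' S X Y S' := by
  obtain ⟨h1, h2, h3⟩ := hv
  refine ⟨fun s => (h1 s).2, fun y => (h2 y).2, fun s s' y => ?_, fun x s y => ?_,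
    fun s => (h1 s).1, fun s' y => (h2 y).1 s', fun s x y s' => h3.1 s x y s'⟩
  · have := congrFun h0 (Sum.inl (s, s', y))
    simp only [marginalDefect, LinearMap.coe_mk, AddHom.coe_mk, Sum.elim_inl, Pi.zero_apply] at this
    linarith
  · have := congrFun h0 (Sum.inr (x, s, y))
    simp only [marginalDefect, LinearMap.coe_mk, AddHom.coe_mk, Sum.elim_inr, Pi.zero_apply] at this
    linarith

/-- The bound W ≤ 1 costs nothing: each entry of W is at most a decoder marginal, itself at most 1.
-/
theorem boxLP_of_mem_feaLP' {v : PrimalPoint S X Y S'} (hv : v ∈ feaLP' S X Y S') :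
    (v.QX, v.QS, v.W) ∈ boxLP S X Y S' ∧ marginalDefect S X Y S' (v.QX, v.QS, v.W) = 0 := by
  obtain ⟨hX, hS, hWS, hWX, hXn, hSn, hWn⟩ := hv
  refine ⟨⟨fun s => ⟨hXn s, hX s⟩, fun y => ⟨fun s' => hSn s' y, hS y⟩, ⟨hWn, ?_⟩⟩, ?_⟩
  · intro s x y s'
    calc v.W s x y s' ≤ ∑ x', v.W s x' y s' :=
          Finset.single_le_sum (f := fun x' => v.W s x' y s')
            (fun i _ => hWn s i y s') (Finset.mem_univ x)
      _ = v.QS y s' := by linarith [hWS s s' y]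
      _ ≤ ∑ i, v.QS y i := Finset.single_le_sum (fun i _ => hSn i y) (Finset.mem_univ s')
      _ = 1 := hS y
  · funext i
    rcases i with ⟨s, s', y⟩ | ⟨x, s, y⟩
    · simp only [marginalDefect, LinearMap.coe_mk, AddHom.coe_mk, Sum.elim_inl, Pi.zero_apply]
      linarith [hWS s s' y]
    · simp only [marginalDefect, LinearMap.coe_mk, AddHom.coe_mk, Sum.elim_inr, Pi.zero_apply]
      linarith [hWX x s y]

theorem feaLP'_nonempty [Nonempty X] [Nonempty S'] : (feaLP' S X Y S').Nonempty := by
  classical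
  obtain ⟨x₀⟩ := ‹Nonempty X›
  obtain ⟨t₀⟩ := ‹Nonempty S'›
  refine ⟨⟨fun _ x => if x = x₀ then 1 else 0, fun _ s' => if s' = t₀ then 1 else 0,
    fun _ x _ s' => (if x = x₀ then 1 else 0) * (if s' = t₀ then 1 else 0)⟩,
    by simp, by simp, by simp, by simp, ?_, ?_, ?_⟩ <;> intros <;> dsimp only <;>
    split_ifs <;> norm_num

end Marginals

/-! ### Attainment and strong duality for LP'. -/

section General

variable {S X Y S' : Type*} [Fintype S] [Fintype X] [Fintype Y] [Fintype S']

/-- The objective of LP' as a linear functional. -/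
def objLinear (PS : S → ℝ) (P : X → Y → ℝ) (κ : S → X → Y → S' → ℝ) :
    ((S → X → ℝ) × (Y → S' → ℝ) × (S → X → Y → S' → ℝ)) →ₗ[ℝ] ℝ where
  toFun v := objLP' PS P κ ⟨v.1, v.2.1, v.2.2⟩
  map_add' v w := by
    simp [objLP', mul_add, Finset.sum_add_distrib]
  map_smul' c v := by
    simp only [objLP', Prod.smul_snd, Pi.smul_apply, smul_eq_mul, Finset.mul_sum, RingHom.id_apply]
    congr! 4
    ring

theorem continuous_objLinear (PS : S → ℝ) (P : X → Y → ℝ) (κ : S → X → Y → S' → ℝ) :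
    Continuous (objLinear PS P κ) := by
  change Continuous fun v : (S → X → ℝ) × (Y → S' → ℝ) × (S → X → Y → S' → ℝ) =>
    objLP' PS P κ ⟨v.1, v.2.1, v.2.2⟩
  unfold objLP'
  fun_prop

/-- LP' attains its optimal value. -/
theorem exists_objLP'_le [Nonempty X] [Nonempty S'] {PS : S → ℝ} {P : X → Y → ℝ}
    {κ : S → X → Y → S' → ℝ} {r : ℝ} (h : optLP' PS P κ ≤ (r : EReal)) :
    ∃ v ∈ feaLP' S X Y S', objLP' PS P κ v ≤ r := by
  obtain ⟨v₀, hv₀⟩ := feaLP'_nonempty (S := S) (X := X) (Y := Y) (S' := S')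
  have hc : IsCompact (boxLP S X Y S' ∩ marginalDefect S X Y S' ⁻¹' {0}) :=
    isCompact_boxLP.inter_right (isClosed_singleton.preimage continuous_marginalDefect)
  obtain ⟨v, ⟨hv, hv0⟩, hmin⟩ := hc.exists_isMinOn ⟨_, boxLP_of_mem_feaLP' hv₀⟩
    (continuous_objLinear PS P κ).continuousOn
  have hmin' : ∀ w ∈ feaLP' S X Y S', objLP' PS P κ ⟨v.1, v.2.1, v.2.2⟩ ≤ objLP' PS P κ w :=
    fun w hw => isMinOn_iff.1 hmin (w.QX, w.QS, w.W) (boxLP_of_mem_feaLP' hw)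
  refine ⟨⟨v.1, v.2.1, v.2.2⟩, mk_mem_feaLP' hv hv0, ?_⟩
  rw [← EReal.coe_le_coe_iff]
  exact le_trans (le_iInf₂ fun w hw => EReal.coe_le_coe_iff.2 (hmin' w hw)) h

/-- Strong duality between LP' and DP'. -/
theorem optLP'_le_optDP' [Nonempty X] [Nonempty S'] (PS : S → ℝ) (P : X → Y → ℝ)
    (κ : S → X → Y → S' → ℝ) : optLP' PS P κ ≤ optDP' PS P κ := by
  classical
  refine EReal.ge_of_forall_gt_iff_ge.1 fun r hr => ?_
  obtain ⟨v₀, hv₀⟩ := feaLP'_nonempty (S := S) (X := X) (Y := Y) (S' := S')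
  obtain ⟨hv₁, hv₂⟩ := boxLP_of_mem_feaLP' hv₀
  obtain ⟨l, hl⟩ := exists_multiplier isCompact_boxLP convex_boxLP (marginalDefect S X Y S')
    continuous_marginalDefect (objLinear PS P κ) (continuous_objLinear PS P κ) hv₁ hv₂ (r := r)
    (fun v hv hv0 => by
      rw [← EReal.coe_lt_coe_iff]
      exact hr.trans_le (iInf₂_le _ (mk_mem_feaLP' hv hv0)))
  set la : S → S' → Y → ℝ := fun s s' y => l (Sum.inl (s, s', y)) with hla
  set lb : X → S → Y → ℝ := fun x s y => l (Sum.inr (x, s, y)) with hlb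
  -- The Lagrangian bound regrouped by variable: it decouples into separate terms in W, the decoder
  -- and the encoder.
  have hlag : ∀ QX ∈ condDist S X, ∀ QS ∈ condDist Y S', ∀ W : S → X → Y → S' → ℝ,
      (∀ s x y s', 0 ≤ W s x y s') → (∀ s x y s', W s x y s' ≤ 1) →
      r ≤ (∑ s, ∑ x, ∑ y, ∑ s', (κ s x y s' * PS s * P x y - la s s' y - lb x s y) * W s x y s') +
        (∑ y, ∑ s', QS y s' * ∑ s, la s s' y) + ∑ s, ∑ x, QX s x * ∑ y, lb x s y := by
    intro QX hQX QS hQS W hW0 hW1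
    have h := hl (QX, QS, W) ⟨hQX, hQS, hW0, hW1⟩
    refine h.trans_eq ?_
    have ea : ∑ s, ∑ s', ∑ y, la s s' y * (QS y s' - ∑ x, W s x y s') =
        (∑ y, ∑ s', QS y s' * ∑ s, la s s' y) -
          ∑ s, ∑ x, ∑ y, ∑ s', la s s' y * W s x y s' := by
      have e1 : ∑ s, ∑ s', ∑ y, la s s' y * QS y s' = ∑ y, ∑ s', QS y s' * ∑ s, la s s' y := by
        simp only [Finset.mul_sum]
        rw [Finset.sum_comm, Finset.sum_comm (γ := Y)]
        refine Finset.sum_congr rfl fun s' _ => ?_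
        rw [Finset.sum_comm]
        simp only [mul_comm]
      have e2 : ∑ s, ∑ s', ∑ y, la s s' y * ∑ x, W s x y s' =
          ∑ s, ∑ x, ∑ y, ∑ s', la s s' y * W s x y s' := by
        refine Finset.sum_congr rfl fun s _ => ?_
        simp only [Finset.mul_sum]
        rw [Finset.sum_comm, Finset.sum_comm (γ := X)]
        refine Finset.sum_congr rfl fun y _ => ?_
        rw [Finset.sum_comm]
      simp only [mul_sub, Finset.sum_sub_distrib]
      rw [e1, e2]
    have eb : ∑ x, ∑ s, ∑ y, lb x s y * (QX s x - ∑ s', W s x y s') =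
        (∑ s, ∑ x, QX s x * ∑ y, lb x s y) -
          ∑ s, ∑ x, ∑ y, ∑ s', lb x s y * W s x y s' := by
      rw [Finset.sum_comm]
      simp only [mul_sub, Finset.sum_sub_distrib, Finset.mul_sum]
      simp only [mul_comm]
    simp only [Fintype.sum_sum_type, Fintype.sum_prod_type]
    simp only [marginalDefect, objLinear, LinearMap.coe_mk, AddHom.coe_mk, Sum.elim_inl,
      Sum.elim_inr, objLP']
    rw [ea, eb]
    simp only [sub_mul, Finset.sum_sub_distrib]
    ring
  -- ν is the price of the artificial bound W ≤ 1, that is, the violation of the last dual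
  -- constraint. Subtracting its sum over s' from λᵇ restores that constraint with μ = 0.
  set ν : S → X → Y → S' → ℝ := fun s x y s' =>
    max 0 (la s s' y + lb x s y - κ s x y s' * PS s * P x y) with hν
  set lb' : X → S → Y → ℝ := fun x s y => lb x s y - ∑ s', ν s x y s' with hlb'
  have hg : ∀ y, ∃ a : S', ∀ b : S', ∑ s, la s a y ≤ ∑ s, la s b y := fun y => by
    obtain ⟨a, -, ha⟩ := Finset.exists_min_image Finset.univ
      (fun b : S' => ∑ s, la s b y) Finset.univ_nonempty
    exact ⟨a, fun b => ha b (Finset.mem_univ b)⟩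
  choose g hg using hg
  have hf : ∀ s, ∃ a : X, ∀ b : X, ∑ y, lb' a s y ≤ ∑ y, lb' b s y := fun s => by
    obtain ⟨a, -, ha⟩ := Finset.exists_min_image Finset.univ
      (fun b : X => ∑ y, lb' b s y) Finset.univ_nonempty
    exact ⟨a, fun b => ha b (Finset.mem_univ b)⟩
  choose f hf using hf
  have hν0 : ∀ s x y s', 0 ≤ ν s x y s' := fun s x y s' => le_max_left _ _
  have hfeas : (⟨fun s => ∑ y, lb' (f s) s y, fun y => ∑ s, la s (g y) y, la, lb',
      fun _ _ _ _ => 0⟩ : DualPoint S X Y S') ∈ feaDP' PS P κ := by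
    refine ⟨⟨fun x s => ?_, fun s' y => ?_, fun s x y s' => ?_, fun _ _ _ _ => le_rfl⟩,
      fun _ _ _ _ => rfl⟩
    · simpa using hf s x
    · simpa using hg y s'
    · have h1 : ν s x y s' ≤ ∑ i, ν s x y i :=
        Finset.single_le_sum (fun i _ => hν0 s x y i) (Finset.mem_univ s')
      have h2 : la s s' y + lb x s y - κ s x y s' * PS s * P x y ≤ ν s x y s' := le_max_right _ _
      simp only [hlb']
      linarith
  refine le_trans ?_ (le_iSup₂ _ hfeas)
  rw [EReal.coe_le_coe_iff]
  -- Point masses at f and g, with W equal to 1 exactly where its coefficient is negative, make the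
  -- W-term equal to minus the total of ν.
  have h := hlag (fun s x => if x = f s then 1 else 0)
    (fun s => single_mem_stdSimplex_ite (f s)) (fun y s' => if s' = g y then 1 else 0)
    (fun y => single_mem_stdSimplex_ite (g y))
    (fun s x y s' => if κ s x y s' * PS s * P x y - la s s' y - lb x s y < 0 then 1 else 0)
    (fun s x y s' => by split_ifs <;> norm_num) (fun s x y s' => by split_ifs <;> norm_num)
  have hνe : ∀ s x y s', (κ s x y s' * PS s * P x y - la s s' y - lb x s y) *
      (if κ s x y s' * PS s * P x y - la s s' y - lb x s y < 0 then (1 : ℝ) else 0) =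
      -ν s x y s' := by
    intro s x y s'
    simp only [hν]
    split_ifs with h0
    · rw [max_eq_right (by linarith)]; ring
    · rw [max_eq_left (by linarith)]; ring
  simp only [hνe, ite_mul, one_mul, zero_mul, Finset.sum_ite_eq', Finset.mem_univ, if_true,
    Finset.sum_neg_distrib] at h
  -- The corrected dual point loses ν only along the graph of f, while the Lagrangian bound has
  -- already paid for all of ν.
  have hsum : ∑ s, ∑ y, ∑ s', ν s (f s) y s' ≤ ∑ s, ∑ x, ∑ y, ∑ s', ν s x y s' :=
    Finset.sum_le_sum fun s _ =>
      Finset.single_le_sum (f := fun x => ∑ y, ∑ s', ν s x y s')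
        (fun x _ => Finset.sum_nonneg fun y _ => Finset.sum_nonneg fun s' _ => hν0 s x y s')
        (Finset.mem_univ (f s))
  simp only [objDP, hlb', Finset.sum_sub_distrib, Finset.sum_const_zero, sub_zero]
  linarith

theorem optLP'_eq_optDP' [Nonempty X] [Nonempty S'] (PS : S → ℝ) (P : X → Y → ℝ)
    (κ : S → X → Y → S' → ℝ) : optLP' PS P κ = optDP' PS P κ :=
  le_antisymm (optLP'_le_optDP' PS P κ) (optDP'_le_optLP' PS P κ)

end General

/-! ### Equivalence of NS and LP' for channel coding. -/

section ChannelCoding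

variable {X Y : Type*} [Fintype X] [Fintype Y]

-- The mass of W(s,·,y,·) equals both the encoder total at s and the decoder total at y. A single
-- normalisation thus gives the other two, provided an output and a message exist.
omit [Fintype Y] in
theorem feaNS_eq_feaLP' [Nonempty Y] {M : ℕ} (hM : 1 ≤ M) :
    feaNS X Y M = feaLP' (Fin M) X Y (Fin M) := by
  have hQX : ∀ v : PrimalPoint (Fin M) X Y (Fin M),
      (∀ x s y, ∑ s', v.W s x y s' - v.QX s x = 0) →
      ∀ s y, ∑ x, ∑ s', v.W s x y s' = ∑ x, v.QX s x := fun v h s y =>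
    Finset.sum_congr rfl fun x _ => sub_eq_zero.1 (h x s y)
  have hQS : ∀ v : PrimalPoint (Fin M) X Y (Fin M),
      (∀ s s' y, ∑ x, v.W s x y s' - v.QS y s' = 0) →
      ∀ s y, ∑ x, ∑ s', v.W s x y s' = ∑ s', v.QS y s' := fun v h s y => by
    rw [Finset.sum_comm]
    exact Finset.sum_congr rfl fun s' _ => sub_eq_zero.1 (h s s' y)
  ext v
  constructor
  · rintro ⟨h1, h2, h3, h4⟩
    refine ⟨fun s => ?_, fun y => ?_, h1, h2, h4⟩
    · obtain ⟨y⟩ := ‹Nonempty Y›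
      rw [← hQX v h2 s y, h3]
    · rw [← hQS v h1 ⟨0, hM⟩ y, h3]
  · rintro ⟨h1, h2, h3, h4, h5⟩
    exact ⟨h3, h4, fun s y => by rw [hQX v h4, h1], h5⟩

theorem objNS_eq_objLP' {P : X → Y → ℝ} (hP : P ∈ condDist X Y) {M : ℕ} (hM : 1 ≤ M)
    {v : PrimalPoint (Fin M) X Y (Fin M)} (hv : v ∈ feaLP' (Fin M) X Y (Fin M)) :
    objNS P M v = objLP' (unif M) P (errLoss X Y M) v := by
  obtain ⟨h1, -, -, h4, -⟩ := hv
  have hM0 : (M : ℝ) ≠ 0 := by positivity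
  -- The loss is 1 minus the indicator of s' = s; the constant 1 sums W to the encoder marginal.
  have e1 : ∀ s x y, ∑ s', errLoss X Y M s x y s' * unif M s * P x y * v.W s x y s' =
      1 / (M : ℝ) * (P x y * v.QX s x) - 1 / (M : ℝ) * (P x y * v.W s x y s) := by
    intro s x y
    have : ∀ s', errLoss X Y M s x y s' * unif M s * P x y * v.W s x y s' =
        1 / (M : ℝ) * (P x y * v.W s x y s') -
          if s' = s then 1 / (M : ℝ) * (P x y * v.W s x y s') else 0 := by
      intro s'
      by_cases hs : s' = s
      · simp [errLoss, hs]
      · simp [errLoss, hs, Ne.symm hs, unif, mul_assoc]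
    simp only [this, Finset.sum_sub_distrib, Finset.sum_ite_eq', Finset.mem_univ, if_true,
      ← Finset.mul_sum, sub_eq_zero.1 (h4 x s y)]
  have e2 : ∑ s, ∑ x, ∑ y, 1 / (M : ℝ) * (P x y * v.QX s x) = 1 := by
    have : ∀ s : Fin M, ∀ x, ∑ y, 1 / (M : ℝ) * (P x y * v.QX s x) = 1 / (M : ℝ) * v.QX s x := by
      intro s x
      rw [← Finset.mul_sum, ← Finset.sum_mul, (hP x).2, one_mul]
    simp only [this, ← Finset.mul_sum, h1]
    simp [hM0]
  simp only [objNS, objLP', e1, Finset.sum_sub_distrib, e2, Finset.mul_sum]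

/-! ### Test levels and the PPV saddle value. -/

/-- Levels `t` such that, for some input distribution `P_X`, a sub-joint weight `R ≤ P_X` has power
at least `1 - ε` and total weight at most `t` on every output. -/
def testLevels (P : X → Y → ℝ) (ε : ℝ) : Set ℝ :=
  {t | ∃ PX ∈ stdSimplex ℝ X, ∃ R : X → Y → ℝ, (∀ x y, 0 ≤ R x y ∧ R x y ≤ PX x) ∧
    1 - ε ≤ ∑ x, ∑ y, P x y * R x y ∧ ∀ y, ∑ x, R x y ≤ t}

theorem testLevels_mono {P : X → Y → ℝ} {ε t u : ℝ} (ht : t ∈ testLevels P ε) (htu : t ≤ u) :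
    u ∈ testLevels P ε := by
  obtain ⟨PX, hPX, R, h1, h2, h3⟩ := ht
  exact ⟨PX, hPX, R, h1, h2, fun y => (h3 y).trans htu⟩

theorem one_mem_testLevels [Nonempty X] {P : X → Y → ℝ} (hP : P ∈ condDist X Y) {ε : ℝ}
    (hε : 0 ≤ ε) : 1 ∈ testLevels P ε := by
  classical
  obtain ⟨x₀⟩ := ‹Nonempty X›
  have h0 := single_mem_stdSimplex_ite x₀
  refine ⟨_, h0, fun x _ => if x = x₀ then 1 else 0, fun x _ => ⟨h0.1 x, le_rfl⟩, ?_,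
    fun _ => h0.2.le⟩
  simp only [← Finset.sum_mul, (hP _).2]
  simpa using hε

/-- Since P ≤ 1, the power is at most the total weight; a level t ≤ 0 would make that nonpositive,
against power at least 1 - ε > 0. -/
theorem testLevels_pos {P : X → Y → ℝ} (hP : P ∈ condDist X Y) {ε t : ℝ}
    (hε : ε < 1) (ht : t ∈ testLevels P ε) : 0 < t := by
  obtain ⟨PX, hPX, R, h1, h2, h3⟩ := ht
  by_contra hcon
  push Not at hcon
  have : ∑ x, ∑ y, P x y * R x y ≤ ∑ x, ∑ y, R x y := by
    gcongr with x _ y _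
    have hP1 : P x y ≤ 1 := by
      rw [← (hP x).2]
      exact Finset.single_le_sum (fun i _ => (hP x).1 i) (Finset.mem_univ y)
    nlinarith [(h1 x y).1]
  have h4 : ∑ x, ∑ y, R x y ≤ 0 := by
    rw [Finset.sum_comm]
    exact Finset.sum_nonpos fun y _ => (h3 y).trans hcon
  linarith

/-- Level 1 is always available, so only levels in [0, 1] matter, and the triples (P_X, R, t) with
such t form a compact set. -/
theorem exists_isLeast_testLevels [Nonempty X] [Nonempty Y] {P : X → Y → ℝ}
    (hP : P ∈ condDist X Y) {ε : ℝ} (hε : 0 ≤ ε) : ∃ t, IsLeast (testLevels P ε) t := by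
  set K : Set ((X → ℝ) × (X → Y → ℝ) × ℝ) :=
    (stdSimplex ℝ X ×ˢ Set.Icc 0 1 ×ˢ Set.Icc 0 1) ∩
      ({v | ∀ x y, v.2.1 x y ≤ v.1 x} ∩ {v | 1 - ε ≤ ∑ x, ∑ y, P x y * v.2.1 x y} ∩
        {v | ∀ y, ∑ x, v.2.1 x y ≤ v.2.2}) with hKdef
  have hK : IsCompact K := by
    refine ((isCompact_stdSimplex ℝ X).prod (isCompact_Icc.prod isCompact_Icc)).inter_right
      ((IsClosed.inter ?_ ?_).inter ?_)
    · simp only [Set.ofPred_forall]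
      exact isClosed_iInter fun x => isClosed_iInter fun y =>
        isClosed_le (by fun_prop) (by fun_prop)
    · exact isClosed_le (by fun_prop) (by fun_prop)
    · simp only [Set.ofPred_forall]
      exact isClosed_iInter fun y => isClosed_le (by fun_prop) (by fun_prop)
  have hmem : ∀ t, t ∈ testLevels P ε → t ≤ 1 → t ∈ (fun v => v.2.2) '' K := by
    rintro t ⟨PX, hPX, R, h1, h2, h3⟩ ht
    have ht0 : 0 ≤ t := by
      obtain ⟨y⟩ := ‹Nonempty Y›
      exact (Finset.sum_nonneg fun x _ => (h1 x y).1).trans (h3 y)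
    have hPX1 : ∀ x, PX x ≤ 1 := fun x => by
      rw [← hPX.2]
      exact Finset.single_le_sum (fun i _ => hPX.1 i) (Finset.mem_univ x)
    exact ⟨(PX, R, t), ⟨⟨hPX, ⟨fun x y => (h1 x y).1, fun x y => (h1 x y).2.trans (hPX1 x)⟩,
      ht0, ht⟩, ⟨fun x y => (h1 x y).2, h2⟩, h3⟩, rfl⟩
  have h1 := one_mem_testLevels hP hε
  obtain ⟨t, ⟨⟨PX, R, t'⟩, ⟨⟨hPX, hR, -⟩, ⟨hRP, hpow⟩, hlev⟩, rfl⟩, hleast⟩ :=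
    (hK.image (f := fun v => v.2.2) (by fun_prop)).exists_isLeast ⟨1, hmem 1 h1 le_rfl⟩
  refine ⟨t', ⟨PX, hPX, R, fun x y => ⟨hR.1 x y, hRP x y⟩, hpow, hlev⟩, fun u hu => ?_⟩
  rcases le_total u 1 with h | h
  · exact hleast (hmem u hu h)
  · exact (hleast (hmem 1 h1 le_rfl)).trans h

theorem convex_tests {R : Type*} [Fintype R] (α : ℝ) (P : R → ℝ) : Convex ℝ (tests α P) := by
  rintro T ⟨hT, hTα⟩ U ⟨hU, hUα⟩ a b ha hb hab
  refine ⟨fun r => ?_, ?_⟩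
  · simp only [Pi.add_apply, Pi.smul_apply, smul_eq_mul]
    constructor
    · have := (hT r).1; have := (hU r).1; positivity
    · nlinarith [(hT r).2, (hU r).2]
  · have : ∑ r, (a • T + b • U) r * P r = a * ∑ r, T r * P r + b * ∑ r, U r * P r := by
      simp only [Pi.add_apply, Pi.smul_apply, smul_eq_mul, Finset.mul_sum,
        ← Finset.sum_add_distrib]
      exact Finset.sum_congr rfl fun r _ => by ring
    rw [this]
    calc α = a * α + b * α := by rw [← add_mul, hab, one_mul]
      _ ≤ _ := by gcongr

/-- The saddle value of the PPV bound. -/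
theorem boundPPV_eq [Nonempty Y] {P : X → Y → ℝ} (hP : P ∈ condDist X Y)
    {ε : ℝ} (hε0 : 0 ≤ ε) (hε : ε < 1) {t : ℝ} (ht : IsLeast (testLevels P ε) t) :
    boundPPV P ε = ENNReal.ofReal t⁻¹ := by
  have htpos := testLevels_pos hP hε ht.1
  rw [ENNReal.ofReal_inv_of_pos htpos]
  apply le_antisymm
  · refine iSup₂_le fun PX hPX => ?_
    set K : Set (X × Y → ℝ) := tests (1 - ε) (fun r : X × Y => P r.1 r.2 * PX r.1) with hKdef
    let A : (X × Y → ℝ) →ₗ[ℝ] (Y → ℝ) :=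
      { toFun := fun T y => ∑ x, PX x * T (x, y)
        map_add' := fun T U => by ext y; simp [mul_add, Finset.sum_add_distrib]
        map_smul' := fun c T => by
          ext y
          simp only [Pi.smul_apply, smul_eq_mul, Finset.mul_sum, RingHom.id_apply]
          exact Finset.sum_congr rfl fun x _ => by ring }
    have hKne : K.Nonempty := by
      refine ⟨fun _ => 1, fun _ => ⟨zero_le_one, le_rfl⟩, ?_⟩
      simp only [one_mul, Fintype.sum_prod_type, ← Finset.sum_mul, (hP _).2, hPX.2]
      linarith
    -- For each test T the weight P_X T has some output total at least t, by minimality of t.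
    -- Separation yields one Q_Y that works for all tests, so β ≥ t.
    obtain ⟨QY, hQY, hQYt⟩ := exists_stdSimplex_forall_le (hKne.image A)
      ((convex_tests _ _).linear_image A) (t := t) (by
        rintro _ ⟨T, ⟨hT1, hT2⟩, rfl⟩
        obtain ⟨y, -, hy⟩ := Finset.exists_max_image Finset.univ (A T) Finset.univ_nonempty
        refine ⟨y, ht.2 ⟨PX, hPX, fun x y => PX x * T (x, y), fun x y => ⟨?_, ?_⟩, ?_,
          fun y' => hy y' (Finset.mem_univ y')⟩⟩
        · exact mul_nonneg (hPX.1 x) (hT1 _).1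
        · exact mul_le_of_le_one_right (hPX.1 x) (hT1 _).2
        · rw [Fintype.sum_prod_type] at hT2
          refine hT2.trans_eq ?_
          exact Finset.sum_congr rfl fun x _ => Finset.sum_congr rfl fun y _ => by ring)
    refine iInf₂_le_of_le QY hQY (ENNReal.inv_le_inv.2 ?_)
    refine le_iInf₂ fun T hT => ENNReal.ofReal_le_ofReal ((hQYt _ ⟨T, hT, rfl⟩).trans_eq ?_)
    rw [Fintype.sum_prod_type, Finset.sum_comm]
    refine Finset.sum_congr rfl fun y _ => ?_
    change QY y * ∑ x, PX x * T (x, y) = _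
    rw [Finset.mul_sum]
    exact Finset.sum_congr rfl fun x _ => by ring
  · obtain ⟨PX, hPX, R, hR, hpow, hlev⟩ := ht.1
    refine le_iSup₂_of_le PX hPX (le_iInf₂ fun QY hQY => ENNReal.inv_le_inv.2 ?_)
    -- The test is R / P_X. Where P_X vanishes so does R, so the convention 0 / 0 = 0 is harmless.
    have hTR : ∀ x y, R x y / PX x * PX x = R x y := by
      intro x y
      by_cases h0 : PX x = 0
      · have := hR x y
        rw [h0] at this ⊢
        linarith
      · exact div_mul_cancel₀ _ h0
    refine iInf₂_le_of_le (fun r => R r.1 r.2 / PX r.1) ⟨fun r => ⟨?_, ?_⟩, ?_⟩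
      (ENNReal.ofReal_le_ofReal ?_)
    · exact div_nonneg (hR _ _).1 (hPX.1 _)
    · exact div_le_one_of_le₀ (hR _ _).2 (hPX.1 _)
    · rw [Fintype.sum_prod_type]
      refine hpow.trans_eq ?_
      refine Finset.sum_congr rfl fun x _ => Finset.sum_congr rfl fun y _ => ?_
      rw [mul_left_comm, hTR]
    · simp only [Fintype.sum_prod_type, ← mul_assoc, hTR]
      rw [Finset.sum_comm]
      simp only [← Finset.sum_mul]
      calc ∑ y, (∑ x, R x y) * QY y ≤ ∑ y, t * QY y :=
            Finset.sum_le_sum fun y _ => mul_le_mul_of_nonneg_right (hlev y) (hQY.1 y)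
        _ = t := by rw [← Finset.mul_sum, hQY.2, mul_one]

/-! ### Test levels versus the value of LP'. -/

/-- A weight below `P_X` with output totals at most `u ≤ 1` can be enlarged to have all output
totals equal to `u`. -/
theorem exists_sum_eq_of_mem_testLevels {P : X → Y → ℝ} (hP : P ∈ condDist X Y) {ε u : ℝ}
    (hu : u ∈ testLevels P ε) (hu1 : u ≤ 1) :
    ∃ PX ∈ stdSimplex ℝ X, ∃ R : X → Y → ℝ, (∀ x y, 0 ≤ R x y ∧ R x y ≤ PX x) ∧
      1 - ε ≤ ∑ x, ∑ y, P x y * R x y ∧ ∀ y, ∑ x, R x y = u := by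
  obtain ⟨PX, hPX, R, hR, hpow, hlev⟩ := hu
  -- Output by output, R is moved towards P_X, whose total is 1 ≥ u; the total is affine in a.
  have key : ∀ y, ∃ a : ℝ, 0 ≤ a ∧ a ≤ 1 ∧ ∑ x, (R x y + a * (PX x - R x y)) = u := by
    intro y
    have hsum : ∀ a : ℝ, ∑ x, (R x y + a * (PX x - R x y)) =
        ∑ x, R x y + a * (1 - ∑ x, R x y) := fun a => by
      rw [Finset.sum_add_distrib, ← Finset.mul_sum, Finset.sum_sub_distrib, hPX.2]
    by_cases h1 : ∑ x, R x y = u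
    · exact ⟨0, le_rfl, zero_le_one, by simpa using h1⟩
    · have h2 : ∑ x, R x y < u := lt_of_le_of_ne (hlev y) h1
      have h3 : 0 < 1 - ∑ x, R x y := by linarith
      refine ⟨(u - ∑ x, R x y) / (1 - ∑ x, R x y), div_nonneg (by linarith) h3.le,
        (div_le_one h3).2 (by linarith), ?_⟩
      rw [hsum, div_mul_cancel₀ _ h3.ne']
      ring
  choose a ha0 ha1 ha using key
  refine ⟨PX, hPX, fun x y => R x y + a y * (PX x - R x y), fun x y => ⟨?_, ?_⟩, ?_, ha⟩
  · exact add_nonneg (hR x y).1 (mul_nonneg (ha0 y) (sub_nonneg.2 (hR x y).2))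
  · nlinarith [(hR x y).2, ha1 y]
  · refine hpow.trans ?_
    gcongr with x _ y _
    · exact (hP x).1 y
    · exact le_add_of_nonneg_right (mul_nonneg (ha0 y) (sub_nonneg.2 (hR x y).2))

theorem optNS_eq_optLP' [Nonempty Y] {P : X → Y → ℝ} (hP : P ∈ condDist X Y) {M : ℕ}
    (hM : 1 ≤ M) : optNS P M = optLP' (unif M) P (errLoss X Y M) := by
  unfold optNS optLP'
  rw [feaNS_eq_feaLP' hM]
  exact biInf_congr fun v hv => by rw [objNS_eq_objLP' hP hM hv]

/-- The LP' point is symmetric in the messages: W is R on the diagonal s' = s, and the rest P_X - R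
is shared equally by the M - 1 wrong messages. -/
theorem optLP'_le_of_mem_testLevels [Nonempty Y] {P : X → Y → ℝ} (hP : P ∈ condDist X Y)
    {ε : ℝ} {M : ℕ} (hM : 1 ≤ M) (h : 1 / (M : ℝ) ∈ testLevels P ε) :
    optLP' (unif M) P (errLoss X Y M) ≤ (ε : EReal) := by
  have hM1 : (1 : ℝ) ≤ M := by exact_mod_cast hM
  have hM0 : (M : ℝ) ≠ 0 := by positivity
  obtain ⟨PX, hPX, R, hR, hpow, hlev⟩ := exists_sum_eq_of_mem_testLevels hP h
    ((div_le_one (by positivity)).2 hM1)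
  have hsum : ∀ (s : Fin M) (x : X) (y : Y),
      ∑ s', (if s' = s then R x y else (PX x - R x y) / ((M : ℝ) - 1)) = PX x := by
    intro s x y
    have h1 : ∀ s' : Fin M, (if s' = s then R x y else (PX x - R x y) / ((M : ℝ) - 1)) =
        (PX x - R x y) / ((M : ℝ) - 1) +
          if s' = s then R x y - (PX x - R x y) / ((M : ℝ) - 1) else 0 := by
      intro s'; split_ifs <;> ring
    simp only [h1, Finset.sum_add_distrib, Finset.sum_ite_eq', Finset.mem_univ, if_true,
      Finset.sum_const, Finset.card_univ, Fintype.card_fin, nsmul_eq_mul]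
    -- For M = 1 nothing may be left over for wrong messages: the output totals 1 force R = P_X.
    rcases eq_or_lt_of_le hM1 with h | h
    · have hx : ∀ x ∈ Finset.univ, R x y = PX x := by
        refine (Finset.sum_eq_sum_iff_of_le fun x _ => (hR x y).2).1 ?_
        rw [hlev y, hPX.2, ← h, div_one]
      rw [← h, hx x (Finset.mem_univ x)]
      simp
    · have : (M : ℝ) - 1 ≠ 0 := by linarith
      field_simp
      ring
  have hsum' : ∀ (s s' : Fin M) (y : Y),
      ∑ x, (if s' = s then R x y else (PX x - R x y) / ((M : ℝ) - 1)) = 1 / (M : ℝ) := by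
    intro s s' y
    split_ifs with hs
    · exact hlev y
    · rw [← Finset.sum_div, Finset.sum_sub_distrib, hPX.2, hlev]
      have : (M : ℝ) - 1 ≠ 0 := by
        intro h0
        have : M = 1 := by exact_mod_cast sub_eq_zero.1 h0
        subst this
        exact hs (Subsingleton.elim _ _)
      field_simp
  set v : PrimalPoint (Fin M) X Y (Fin M) := ⟨fun _ x => PX x, fun _ _ => 1 / (M : ℝ),
    fun s x y s' => if s' = s then R x y else (PX x - R x y) / ((M : ℝ) - 1)⟩ with hv
  have hfeas : v ∈ feaLP' (Fin M) X Y (Fin M) := by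
    refine ⟨fun s => hPX.2, fun y => by simp [hv, hM0], fun s s' y => ?_, fun x s y => ?_,
      fun s x => hPX.1 x, fun s' y => by simp [hv], fun s x y s' => ?_⟩
    · exact sub_eq_zero.2 (hsum' s s' y)
    · exact sub_eq_zero.2 (hsum s x y)
    · simp only [hv]
      split_ifs
      · exact (hR x y).1
      · exact div_nonneg (sub_nonneg.2 (hR x y).2) (by linarith)
  refine iInf₂_le_of_le v hfeas ?_
  rw [EReal.coe_le_coe_iff, ← objNS_eq_objLP' hP hM hfeas]
  simp only [objNS, hv, if_true, Finset.sum_const, Finset.card_univ, Fintype.card_fin,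
    nsmul_eq_mul]
  rw [← mul_assoc, one_div_mul_cancel hM0]
  linarith

/-- An optimal LP' point is averaged over messages: P_X is the mean encoder and R the mean diagonal
of W. Its output totals are 1/M because the decoder marginals sum to 1. -/
theorem mem_testLevels_of_optLP'_le [Nonempty X] {P : X → Y → ℝ} (hP : P ∈ condDist X Y)
    {ε : ℝ} {M : ℕ} (hM : 1 ≤ M)
    (h : optLP' (unif M) P (errLoss X Y M) ≤ (ε : EReal)) : 1 / (M : ℝ) ∈ testLevels P ε := by
  have : Nonempty (Fin M) := ⟨⟨0, hM⟩⟩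
  have hM0 : (M : ℝ) ≠ 0 := by positivity
  obtain ⟨v, hv, hobj⟩ := exists_objLP'_le h
  rw [← objNS_eq_objLP' hP hM hv] at hobj
  obtain ⟨hX, hS, hWS, hWX, hXn, hSn, hWn⟩ := hv
  refine ⟨fun x => 1 / (M : ℝ) * ∑ s, v.QX s x, ⟨fun x => ?_, ?_⟩,
    fun x y => 1 / (M : ℝ) * ∑ s, v.W s x y s, fun x y => ⟨?_, ?_⟩, ?_, fun y => ?_⟩
  · exact mul_nonneg (by positivity) (Finset.sum_nonneg fun s _ => hXn s x)
  · rw [← Finset.mul_sum, Finset.sum_comm]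
    simp [hX, hM0]
  · exact mul_nonneg (by positivity) (Finset.sum_nonneg fun s _ => hWn s x y s)
  · refine mul_le_mul_of_nonneg_left (Finset.sum_le_sum fun s _ => ?_) (by positivity)
    rw [← sub_eq_zero.1 (hWX x s y)]
    exact Finset.single_le_sum (fun i _ => hWn s x y i) (Finset.mem_univ s)
  · have e : ∑ x, ∑ y, P x y * (1 / (M : ℝ) * ∑ s, v.W s x y s) =
        1 / (M : ℝ) * ∑ s, ∑ x, ∑ y, P x y * v.W s x y s := by
      simp only [Finset.mul_sum]
      rw [Finset.sum_comm (γ := Fin M)]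
      refine Finset.sum_congr rfl fun x _ => ?_
      rw [Finset.sum_comm (γ := Fin M)]
      exact Finset.sum_congr rfl fun y _ => Finset.sum_congr rfl fun s _ => by ring
    rw [e]
    simp only [objNS] at hobj
    linarith
  · rw [← Finset.mul_sum, Finset.sum_comm]
    refine le_of_eq ?_
    rw [Finset.sum_congr rfl fun s _ => sub_eq_zero.1 (hWS s s y), hS, mul_one]

/-- The sizes not excluded by DP' are those up to the inverse of the least test level. -/
theorem mem_sizesDP'_iff [Nonempty X] [Nonempty Y] {P : X → Y → ℝ} (hP : P ∈ condDist X Y)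
    {ε : ℝ} (hε : ε < 1) {t : ℝ} (ht : IsLeast (testLevels P ε) t) {M : ℕ} :
    M ∈ sizesDP' P ε ↔ 1 ≤ M ∧ (M : ℝ) ≤ t⁻¹ := by
  refine and_congr_right fun hM => ?_
  have : Nonempty (Fin M) := ⟨⟨0, hM⟩⟩
  have htpos := testLevels_pos hP hε ht.1
  have hMpos : (0 : ℝ) < M := by positivity
  rw [← optLP'_eq_optDP', le_inv_comm₀ hMpos htpos, ← one_div]
  exact ⟨fun h => ht.2 (mem_testLevels_of_optLP'_le hP hM h),
    fun h => optLP'_le_of_mem_testLevels hP hM (testLevels_mono ht.1 h)⟩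

theorem achievableSizes_subset_sizesDP' [Nonempty X] (P : X → Y → ℝ) (ε : ℝ) :
    achievableSizes P ε ⊆ sizesDP' P ε := by
  rintro M ⟨hM, f, g, hfg⟩
  have : Nonempty (Fin M) := ⟨⟨0, hM⟩⟩
  refine ⟨hM, (optDP'_le_optDP _ _ _).trans ((optDP_le_optSC _ _ _).trans ?_)⟩
  rw [← optSCDet_eq_optSC]
  exact iInf₂_le_of_le f g (EReal.coe_le_coe_iff.2 hfg)

omit [Fintype X] in
theorem one_mem_achievableSizes [Nonempty X] (P : X → Y → ℝ) {ε : ℝ} (hε : 0 ≤ ε) :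
    1 ∈ achievableSizes P ε := by
  obtain ⟨x⟩ := ‹Nonempty X›
  refine ⟨le_rfl, fun _ => x, fun _ => 0, ?_⟩
  simpa [codeLoss, errLoss] using hε

theorem isGreatest_sizesDP' [Nonempty X] [Nonempty Y] {P : X → Y → ℝ} (hP : P ∈ condDist X Y)
    {ε : ℝ} (hε0 : 0 ≤ ε) (hε : ε < 1) :
    IsGreatest (sizesDP' P ε) ⌊(boundPPV P ε).toReal⌋₊ := by
  obtain ⟨t, ht⟩ := exists_isLeast_testLevels hP hε0
  have htpos := testLevels_pos hP hε ht.1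
  have hinv : 0 ≤ t⁻¹ := by positivity
  rw [boundPPV_eq hP hε0 hε ht, ENNReal.toReal_ofReal hinv]
  refine ⟨(mem_sizesDP'_iff hP hε ht).2 ⟨?_, Nat.floor_le hinv⟩, fun M hM => ?_⟩
  -- The floor is an admissible size since level 1 is attained, which gives t ≤ 1.
  · exact (Nat.one_le_floor_iff _).2
      ((one_le_inv₀ htpos).2 (ht.2 (one_mem_testLevels hP hε0)))
  · exact Nat.le_floor ((mem_sizesDP'_iff hP hε ht).1 hM).2

end ChannelCoding

end SourceChannel

end

theorem mainTheorem9 {X Y : Type*} [Fintype X] [Fintype Y] [Nonempty X]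
    (P : X → Y → ℝ) (hP : P ∈ SourceChannel.condDist X Y) :
    (∀ M : ℕ, 1 ≤ M →
      -- NS and LP' are the same program
      SourceChannel.feaNS X Y M = SourceChannel.feaLP' (Fin M) X Y (Fin M) ∧
      (∀ v ∈ SourceChannel.feaLP' (Fin M) X Y (Fin M), SourceChannel.objNS P M v =
        SourceChannel.objLP' (SourceChannel.unif M) P (SourceChannel.errLoss X Y M) v) ∧
      SourceChannel.optNS P M =
        SourceChannel.optLP' (SourceChannel.unif M) P (SourceChannel.errLoss X Y M) ∧
      SourceChannel.optLP' (SourceChannel.unif M) P (SourceChannel.errLoss X Y M) =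
        SourceChannel.optDP' (SourceChannel.unif M) P (SourceChannel.errLoss X Y M) ∧
      -- the chain of lower bounds on the error probability of any code
      (∀ QX ∈ SourceChannel.condDist (Fin M) X, ∀ QS ∈ SourceChannel.condDist Y (Fin M),
        SourceChannel.optSC (SourceChannel.unif M) P (SourceChannel.errLoss X Y M) ≤
          (SourceChannel.expectedLoss (SourceChannel.unif M) P
            (SourceChannel.errLoss X Y M) QX QS : EReal)) ∧
      SourceChannel.optSCDet (SourceChannel.unif M) P (SourceChannel.errLoss X Y M) =
        SourceChannel.optSC (SourceChannel.unif M) P (SourceChannel.errLoss X Y M) ∧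
      SourceChannel.optDP (SourceChannel.unif M) P (SourceChannel.errLoss X Y M) ≤
        SourceChannel.optSC (SourceChannel.unif M) P (SourceChannel.errLoss X Y M) ∧
      SourceChannel.optDP' (SourceChannel.unif M) P (SourceChannel.errLoss X Y M) ≤
        SourceChannel.optDP (SourceChannel.unif M) P (SourceChannel.errLoss X Y M)) ∧
    (∀ ε : ℝ, 0 ≤ ε → ε < 1 →
      -- both maxima exist, and the PPV bound is finite
      IsGreatest (SourceChannel.achievableSizes P ε) (SourceChannel.maxCodeSize P ε) ∧
      IsGreatest (SourceChannel.sizesDP' P ε) (SourceChannel.maxSizeDP' P ε) ∧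
      SourceChannel.boundPPV P ε ≠ ⊤ ∧
      SourceChannel.maxCodeSize P ε ≤ SourceChannel.maxSizeDP' P ε ∧
      SourceChannel.maxSizeDP' P ε = ⌊(SourceChannel.boundPPV P ε).toReal⌋₊) := by
  -- An empty output alphabet would make the row sums of P zero instead of 1.
  have : Nonempty Y := by
    by_contra hY
    rw [not_nonempty_iff] at hY
    simpa using (hP (Classical.arbitrary X)).2
  refine ⟨fun M hM => ?_, fun ε hε0 hε => ?_⟩
  · have : Nonempty (Fin M) := ⟨⟨0, hM⟩⟩
    exact ⟨SourceChannel.feaNS_eq_feaLP' hM,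
      fun v hv => SourceChannel.objNS_eq_objLP' hP hM hv,
      SourceChannel.optNS_eq_optLP' hP hM, SourceChannel.optLP'_eq_optDP' _ _ _,
      fun QX hQX QS hQS => iInf₂_le_of_le QX hQX (iInf₂_le QS hQS),
      SourceChannel.optSCDet_eq_optSC _ _ _, SourceChannel.optDP_le_optSC _ _ _,
      SourceChannel.optDP'_le_optDP _ _ _⟩
  · have hgr := SourceChannel.isGreatest_sizesDP' hP hε0 hε
    have heq : SourceChannel.maxSizeDP' P ε = ⌊(SourceChannel.boundPPV P ε).toReal⌋₊ :=
      hgr.csSup_eq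
    have hsub := SourceChannel.achievableSizes_subset_sizesDP' P ε
    have hbdd : BddAbove (SourceChannel.achievableSizes P ε) := hgr.bddAbove.mono hsub
    -- The supremum in ℕ is a genuine maximum: size 1 is achievable, and the DP' sizes bound the
    -- set.
    have hmem : SourceChannel.maxCodeSize P ε ∈ SourceChannel.achievableSizes P ε :=
      Nat.sSup_mem ⟨1, SourceChannel.one_mem_achievableSizes P hε0⟩ hbdd
    refine ⟨⟨hmem, fun M hM => le_csSup hbdd hM⟩, heq ▸ hgr, ?_, ?_, heq⟩
    · obtain ⟨t, ht⟩ := SourceChannel.exists_isLeast_testLevels hP hε0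
      rw [SourceChannel.boundPPV_eq hP hε0 hε ht]
      exact ENNReal.ofReal_ne_top
    · rw [heq]
      exact hgr.2 (hsub hmem)
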